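/- Let $d \ge 3$, let $n_1, \dots, n_d \ge 2$ be integers, and let $t_1, \dots, t_d$ be integers with $0 \le t_i \le n_i$ that are either all positive or all zero. The Lie group $G = \mathrm{GL}(n_1,\mathbb{R}) \times \dots \times \mathrm{GL}(n_d,\mathbb{R})$ acts on $\mathbb{R}^{n_1} \otimes \dots \otimes \mathbb{R}^{n_d}$ by $(g_1,\dots,g_d)\cdot(v_1 \otimes \dots \otimes v_d) = (g_1 v_1) \otimes \dots \otimes (g_d v_d)$. The multilinear rank of a tensor $T$ is the tuple whose $i$-th entry is the rank of the linear map $\mathbb{R}^{n_i} \to \bigotimes_{j \ne i} \mathbb{R}^{n_j}$ defined by $T$. Let $\Lambda$ be the set of tensors of multilinear rank $(t_1,\dots,t_d)$, with the subspace topology, and assume that $t_1 = t_2 \cdots t_d$. Then: 1. $\Lambda$ is nonempty and $G$-invariant, and $G$ acts transitively on $\Lambda$. 2. Fix any bijection between $\{1,\dots,t_1\}$ and $\{1,\dots,t_2\}\times\dots\times\{1,\dots,t_d\}$, and let $T \in \mathbb{R}^{n_1} \otimes \dots \otimes \mathbb{R}^{n_d}$ be the tensor $T_{k_1 \dots k_d}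 = \sum_{\alpha_1,\dots,\alpha_d} I_{\alpha_1 \dots \alpha_d} (E_1)_{k_1\alpha_1} \cdots (E_d)_{k_d\alpha_d}$, where $1 \le \alpha_i \le t_i$, $E_i$ is the $n_i \times t_i$ matrix with entries $\delta_{k\alpha}$, and $I_{\alpha_1\dots\alpha_d}$ is $1$ if $\alpha_1$ corresponds to $(\alpha_2,\dots,\alpha_d)$ and $0$ otherwise. Then $T \in \Lambda$, and the stabilizer $H$ of $T$ in $G$ is exactly the set of all $$ \begin{bmatrix} A_2^{-\mathsf T} \otimes \dots \otimes A_d^{-\mathsf T} & M_1 \\ 0 & B_1 \end{bmatrix} \times \begin{bmatrix} A_2 & M_2 \\ 0 & B_2 \end{bmatrix} \times \dots \times \begin{bmatrix} A_d & M_d \\ 0 & B_d \end{bmatrix}, $$ where the $A_i$ are invertible $t_i \times t_i$ matrices ($2 \le i \le d$), the $B_i$ are invertible $(n_i - t_i) \times (n_i - t_i)$ matrices, the $M_i$ are arbitrary $t_i \times (n_i - t_i)$ matrices ($1 \le i \le d$), and the Kronecker product is read as a $t_1 \times t_1$ matrix through the chosen bijection. 3. $\Lambda$ is a smooth homogeneous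 manifold, $\Lambda = G/H$: there is a smooth ($C^\infty$) manifold structure on the topological space $\Lambda$ for which the action $G \times \Lambda \to \Lambda$ is smooth and, for every $T$ as in 2 with stabilizer $H$, the map $gH \mapsto g \cdot T$ is a homeomorphism from $G/H$ (with the quotient topology) onto $\Lambda$, the map $\pi \colon G \to \Lambda$, $\pi(g) = g \cdot T$, is a smooth submersion, and a function $f \colon \Lambda \to \mathbb{R}$ is smooth if and only if $f \circ \pi$ is smooth. -/

import Mathlib

open scoped Manifold ContDiff

noncomputable section

namespace Tucker

variable {m : ℕ}

/-- Real tensors of order `d = m + 1` and format `n 0 × ⋯ × n m`, i.e. elements of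
`ℝ^(n 0) ⊗ ⋯ ⊗ ℝ^(n m)`, given by their coordinates `T k` in the standard basis. -/
abbrev Tensor (n : Fin (m + 1) → ℕ) : Type := (∀ i, Fin (n i)) → ℝ

/-- The elementary tensor `v 0 ⊗ ⋯ ⊗ v m`. -/
def elementary {n : Fin (m + 1) → ℕ} (v : ∀ i, Fin (n i) → ℝ) : Tensor n :=
  fun k => ∏ i, v i (k i)

/-- The algebra `M_{n 0}(ℝ) × ⋯ × M_{n m}(ℝ)` of tuples of square matrices, which has
`GL(n 0) × ⋯ × GL(n m)` as its group of units. -/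
def MatProd (n : Fin (m + 1) → ℕ) : Type := ∀ i, Matrix (Fin (n i)) (Fin (n i)) ℝ

section

attribute [local instance] Matrix.linftyOpNormedRing Matrix.linftyOpNormedAlgebra

/-- Componentwise ring operations, and a submultiplicative norm (the choice of the norm is
irrelevant, since all norms on this finite-dimensional space are equivalent). -/
instance (n : Fin (m + 1) → ℕ) : NormedRing (MatProd n) :=
  inferInstanceAs (NormedRing (∀ i, Matrix (Fin (n i)) (Fin (n i)) ℝ))

instance (n : Fin (m + 1) → ℕ) : NormedAlgebra ℝ (MatProd n) :=
  inferInstanceAs (NormedAlgebra ℝ (∀ i, Matrix (Fin (n i)) (Fin (n i)) ℝ))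

instance (n : Fin (m + 1) → ℕ) : FiniteDimensional ℝ (MatProd n) :=
  inferInstanceAs (FiniteDimensional ℝ (∀ i, Matrix (Fin (n i)) (Fin (n i)) ℝ))

instance (n : Fin (m + 1) → ℕ) : CompleteSpace (MatProd n) :=
  FiniteDimensional.complete ℝ (MatProd n)

end

theorem MatProd.one_apply (n : Fin (m + 1) → ℕ) (i : Fin (m + 1)) : (1 : MatProd n) i = 1 := rfl

theorem MatProd.mul_apply {n : Fin (m + 1) → ℕ} (A B : MatProd n) (i : Fin (m + 1)) :
    (A * B) i = A i * B i := rfl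

/-- The Lie group `G = GL(n 0) × ⋯ × GL(n m)`, as the unit group of `MatProd n`, with the Lie group
structure of the group of units of a normed algebra. -/
abbrev GLProd (n : Fin (m + 1) → ℕ) : Type := (MatProd n)ˣ

/-- `(A 0 ⊗ ⋯ ⊗ A m) T` in coordinates. -/
def act {n : Fin (m + 1) → ℕ} (A : MatProd n) (T : Tensor n) : Tensor n :=
  fun k => ∑ l : ∀ i, Fin (n i), (∏ i, A i (k i) (l i)) * T l

theorem act_one {n : Fin (m + 1) → ℕ} (T : Tensor n) : act 1 T = T := by
  funext k
  have h : ∀ l : ∀ i, Fin (n i),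
      (∏ i, (1 : MatProd n) i (k i) (l i)) = if k = l then 1 else 0 := by
    intro l
    by_cases hkl : k = l
    · subst hkl; simp [MatProd.one_apply]
    · obtain ⟨i, hi⟩ := Function.ne_iff.mp hkl
      rw [if_neg hkl]
      exact Finset.prod_eq_zero (Finset.mem_univ i) (by simp [MatProd.one_apply, hi])
  simp [act, h]

theorem act_mul {n : Fin (m + 1) → ℕ} (A B : MatProd n) (T : Tensor n) :
    act (A * B) T = act A (act B T) := by
  funext k
  simp only [act, MatProd.mul_apply, Matrix.mul_apply, Finset.prod_univ_sum, Finset.mul_sum,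
    Finset.sum_mul, Fintype.piFinset_univ, Finset.prod_mul_distrib]
  rw [Finset.sum_comm]
  exact Finset.sum_congr rfl fun _ _ => Finset.sum_congr rfl fun _ _ => by ring

/-- The natural action of `G` on tensors. -/
instance {n : Fin (m + 1) → ℕ} : MulAction (GLProd n) (Tensor n) where
  smul g T := act (g : MatProd n) T
  one_smul T := act_one T
  mul_smul _ _ T := act_mul _ _ T

theorem smul_apply {n : Fin (m + 1) → ℕ} (g : GLProd n) (T : Tensor n) (k : ∀ i, Fin (n i)) :
    (g • T) k = ∑ l : ∀ i, Fin (n i), (∏ i, (g : MatProd n) i (k i) (l i)) * T l := rfl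

/-- `g • (v 0 ⊗ ⋯ ⊗ v m) = (g 0 (v 0)) ⊗ ⋯ ⊗ (g m (v m))`. -/
theorem smul_elementary {n : Fin (m + 1) → ℕ} (g : GLProd n) (v : ∀ i, Fin (n i) → ℝ) :
    g • elementary v = elementary fun i => Matrix.mulVec ((g : MatProd n) i) (v i) := by
  funext k
  simp only [smul_apply, elementary, Matrix.mulVec, dotProduct, Finset.prod_univ_sum,
    Fintype.piFinset_univ, Finset.prod_mul_distrib]

/-- The mode-`i` unfolding of `T`: the matrix of the linear map from `ℝ^(n i)` to the tensor product
of the other factors that `T` defines by contraction in mode `i`. -/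
def unfolding {n : Fin (m + 1) → ℕ} (T : Tensor n) (i : Fin (m + 1)) :
    Matrix (∀ j : Fin m, Fin (n (i.succAbove j))) (Fin (n i)) ℝ :=
  Matrix.of fun l k => T (i.insertNth k l)

/-- The multilinear rank. -/
def mrank {n : Fin (m + 1) → ℕ} (T : Tensor n) (i : Fin (m + 1)) : ℕ := (unfolding T i).rank

theorem unfolding_act {n : Fin (m + 1) → ℕ} (A : MatProd n) (T : Tensor n) (i : Fin (m + 1)) :
    unfolding (act A T) i =
      (Matrix.of fun (l l' : ∀ j : Fin m, Fin (n (i.succAbove j))) =>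
        ∏ j, A (i.succAbove j) (l j) (l' j)) * unfolding T i * (A i).transpose := by
  ext l k
  simp only [unfolding, act, Matrix.mul_apply, Matrix.of_apply, Matrix.transpose_apply,
    Finset.sum_mul]
  rw [← (Fin.insertNthEquiv (fun j => Fin (n j)) i).sum_comp, Fintype.sum_prod_type]
  refine Finset.sum_congr rfl fun a _ => Finset.sum_congr rfl fun b _ => ?_
  simp only [Fin.insertNthEquiv_apply, Fin.prod_univ_succAbove _ i, Fin.insertNth_apply_same,
    Fin.insertNth_apply_succAbove]
  have key : ∀ x y z : ℝ, x * y * z = y * z * x := fun x y z => by ring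
  exact key _ _ _

theorem mrank_act_le {n : Fin (m + 1) → ℕ} (A : MatProd n) (T : Tensor n) (i : Fin (m + 1)) :
    mrank (act A T) i ≤ mrank T i := by
  rw [mrank, unfolding_act]
  exact (Matrix.rank_mul_le_left _ _).trans (Matrix.rank_mul_le_right _ _)

theorem mrank_smul {n : Fin (m + 1) → ℕ} (g : GLProd n) (T : Tensor n) :
    mrank (g • T) = mrank T := by
  funext i
  refine le_antisymm (mrank_act_le _ _ _) ?_
  have h := mrank_act_le ((g⁻¹ : GLProd n) : MatProd n) (g • T) i
  have h' : act ((g⁻¹ : GLProd n) : MatProd n) (g • T) = T := inv_smul_smul g T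
  rwa [h'] at h

/-- The set `Λ` of tensors of multilinear rank `t`, with the action of `G` (the multilinear rank is
invariant under `G`). As a topological space it carries the subspace topology. -/
def mrankSet (n t : Fin (m + 1) → ℕ) : SubMulAction (GLProd n) (Tensor n) where
  carrier := {T | mrank T = t}
  smul_mem' g T hT := (mrank_smul g T).trans hT

/-- The tensor with Tucker decomposition `∑ α, I α * ∏ i, E i (k i) (α i)`, where `E i` is the
`n i × t i` identity matrix and `I` is the `t 0 × t 0` identity matrix, seen as an order `m + 1`
tensor through an identification `e` of the indices of `ℝ^(t 0)` and of
`ℝ^(t 1) ⊗ ⋯ ⊗ ℝ^(t m)`. -/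
def baseTensor (n : Fin (m + 1) → ℕ) {t : Fin (m + 1) → ℕ}
    (e : Fin (t 0) ≃ ∀ j : Fin m, Fin (t j.succ)) : Tensor n :=
  fun k => ∑ α : ∀ i, Fin (t i),
    (if e (α 0) = fun j : Fin m => α j.succ then 1 else 0) *
      ∏ i, (if (k i : ℕ) = (α i : ℕ) then 1 else 0)

/-- The Kronecker product `X 1 ⊗ ⋯ ⊗ X m`, as a `t 0 × t 0` matrix through the identification
`e`. -/
def kron {t : Fin (m + 1) → ℕ} (e : Fin (t 0) ≃ ∀ j : Fin m, Fin (t j.succ))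
    (X : ∀ j : Fin m, Matrix (Fin (t j.succ)) (Fin (t j.succ)) ℝ) :
    Matrix (Fin (t 0)) (Fin (t 0)) ℝ :=
  Matrix.of fun a b => ∏ j, X j (e a j) (e b j)

/-- The `p × p` block matrix with rows `[A M]` and `[0 B]`, where `A` is `q × q`. -/
def blockUpper {p q : ℕ} (h : q ≤ p) (A : Matrix (Fin q) (Fin q) ℝ)
    (M : Matrix (Fin q) (Fin (p - q)) ℝ) (B : Matrix (Fin (p - q)) (Fin (p - q)) ℝ) :
    Matrix (Fin p) (Fin p) ℝ :=
  Matrix.reindex (finSumFinEquiv.trans (finCongr (Nat.add_sub_cancel' h)))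
    (finSumFinEquiv.trans (finCongr (Nat.add_sub_cancel' h))) (Matrix.fromBlocks A M 0 B)

/-- The set of all `g` in `G` of the form
`[A_1^{-T} ⊗ ⋯ ⊗ A_m^{-T}, M_0; 0, B_0] × [A_1, M_1; 0, B_1] × ⋯ × [A_m, M_m; 0, B_m]` with
invertible `A_j` of size `t j`, invertible `B_i` of size `n i - t i`, and arbitrary `M_i`. -/
def stabilizerForm {n t : Fin (m + 1) → ℕ} (ht : ∀ i, t i ≤ n i)
    (e : Fin (t 0) ≃ ∀ j : Fin m, Fin (t j.succ)) : Set (GLProd n) :=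
  {g | ∃ (A : ∀ j : Fin m, GL (Fin (t j.succ)) ℝ) (B : ∀ i, GL (Fin (n i - t i)) ℝ)
      (M : ∀ i, Matrix (Fin (t i)) (Fin (n i - t i)) ℝ),
    (g : MatProd n) 0 = blockUpper (ht 0)
      (kron e fun j => ((A j)⁻¹ : GL (Fin (t j.succ)) ℝ).val.transpose) (M 0) (B 0) ∧
    ∀ j : Fin m, (g : MatProd n) j.succ =
      blockUpper (ht j.succ) (A j) (M j.succ) (B j.succ)}

end Tucker

end

/-! Because `t 0` is the product of the other `t j`, the entries of a tensor on the first `t i`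
indices of each mode form, through `e`, a square matrix: its core. The base tensor has identity core
and vanishes elsewhere, and `g` turns its core into `C 0 * (C 1 ⊗ ⋯ ⊗ C m)ᵀ`, where `C i` is the
upper left corner of `g i` (`act_baseTensor_inc`).

Transitivity (`exists_smul_baseTensor_eq`): column reduction in each mode concentrates a tensor of
multilinear rank `t` on its core. The rank in mode 0 makes the core invertible, and a matrix in mode
0 alone carries the identity to it.

Stabilizer (`stabilizer_eq`): preserving the zeros of the base tensor forces each `g i` to be block
upper triangular; preserving the core forces `C 0` to be the Kronecker product of the inverse
transposes.

Manifold: on the open set of invertible cores, stabilizer elements reduce `g` to a unique `frame`,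
whose entries are smooth functions of the tensor (`exists_frame`, `lowerBlock_frame`). This gives a
chart, which transitivity moves to every point. The frames also give smooth local sections of the
orbit map (`exists_contMDiffAt_section`), and these yield openness, submersivity and the test for
smooth functions. -/

noncomputable section

namespace Tucker

/-! ### Embedded submanifolds from local parametrizations -/

section

/-- A smooth local parametrization, with open domain in `E`, of the image of `i : X → V`. -/
structure SmoothParam {X V : Type*} [NormedAddCommGroup V] [NormedSpace ℝ V] (i : X → V)
    (E : Type*) [NormedAddCommGroup E] [NormedSpace ℝ E] where
  source : Set V
  target : Set E
  coord : V → E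
  param : E → X
  isOpen_source : IsOpen source
  isOpen_target : IsOpen target
  contDiffOn_coord : ContDiffOn ℝ ∞ coord source
  contDiffOn_param : ContDiffOn ℝ ∞ (i ∘ param) target
  coord_mem : ∀ x, i x ∈ source → coord (i x) ∈ target
  param_mem : ∀ w ∈ target, i (param w) ∈ source
  param_coord : ∀ x, i x ∈ source → param (coord (i x)) = x
  coord_param : ∀ w ∈ target, coord (i (param w)) = w

namespace SmoothParam

variable {X V E : Type*} [NormedAddCommGroup V] [NormedSpace ℝ V] [NormedAddCommGroup E]
  [NormedSpace ℝ E] {i : X → V}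

/-- Change of the parameter space by a continuous linear equivalence. -/
def mapEquiv {F : Type*} [NormedAddCommGroup F] [NormedSpace ℝ F] (c : SmoothParam i E)
    (L : E ≃L[ℝ] F) : SmoothParam i F where
  source := c.source
  target := L.symm ⁻¹' c.target
  coord := L ∘ c.coord
  param := c.param ∘ L.symm
  isOpen_source := c.isOpen_source
  isOpen_target := c.isOpen_target.preimage L.symm.continuous
  contDiffOn_coord := L.contDiff.comp_contDiffOn c.contDiffOn_coord
  contDiffOn_param := c.contDiffOn_param.comp L.symm.contDiff.contDiffOn fun _ h => h
  coord_mem x hx := by simpa using c.coord_mem x hx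
  param_mem w hw := c.param_mem _ hw
  param_coord x hx := by simpa using c.param_coord x hx
  coord_param w hw := by simpa using congrArg L (c.coord_param _ hw)

/-- Translation of a parametrization by a group element that acts smoothly. -/
def translate {G : Type*} [Group G] [MulAction G X] [MulAction G V]
    (hi : ∀ (g : G) (x : X), i (g • x) = g • i x)
    (hG : ∀ g : G, ContDiff ℝ ∞ fun v : V => g • v) (c : SmoothParam i E) (g : G) :
    SmoothParam i E where
  source := (fun v => g⁻¹ • v) ⁻¹' c.source
  target := c.target
  coord v := c.coord (g⁻¹ • v)
  param w := g • c.param w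
  isOpen_source := c.isOpen_source.preimage (hG _).continuous
  isOpen_target := c.isOpen_target
  contDiffOn_coord := c.contDiffOn_coord.comp (hG _).contDiffOn fun _ h => h
  contDiffOn_param := by
    refine ((hG g).comp_contDiffOn c.contDiffOn_param).congr fun w _ => ?_
    simp [hi]
  coord_mem x hx := by
    have := c.coord_mem (g⁻¹ • x) (by simpa [hi] using hx)
    simpa [hi] using this
  param_mem w hw := by simpa [hi] using c.param_mem w hw
  param_coord x hx := by
    have := c.param_coord (g⁻¹ • x) (by simpa [hi] using hx)
    rw [← hi, this, smul_inv_smul]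
  coord_param w hw := by simpa [hi] using c.coord_param w hw

variable [TopologicalSpace X]

/-- The chart inverse to a parametrization. -/
def chart (hi : Topology.IsEmbedding i) (c : SmoothParam i E) : OpenPartialHomeomorph X E where
  toFun x := c.coord (i x)
  invFun := c.param
  source := i ⁻¹' c.source
  target := c.target
  map_source' x hx := c.coord_mem x hx
  map_target' w hw := c.param_mem w hw
  left_inv' x hx := c.param_coord x hx
  right_inv' w hw := c.coord_param w hw
  open_source := c.isOpen_source.preimage hi.continuous
  open_target := c.isOpen_target
  continuousOn_toFun := c.contDiffOn_coord.continuousOn.comp hi.continuous.continuousOn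
    fun _ h => h
  continuousOn_invFun := hi.isInducing.continuousOn_iff.2 c.contDiffOn_param.continuousOn

/-- The atlas given by a family of parametrizations. -/
@[reducible]
def chartedSpace (hi : Topology.IsEmbedding i) (c : X → SmoothParam i E)
    (hc : ∀ x, i x ∈ (c x).source) : ChartedSpace E X where
  atlas := Set.range fun x => (c x).chart hi
  chartAt x := (c x).chart hi
  mem_chart_source x := hc x
  chart_mem_atlas x := ⟨x, rfl⟩

variable (hi : Topology.IsEmbedding i) (c : X → SmoothParam i E)
    (hc : ∀ x, i x ∈ (c x).source)

/-- A transition map is a smooth parametrization followed by a coordinate map that is smooth on an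
open set of the ambient space. -/
theorem isManifold :
    letI := chartedSpace hi c hc
    IsManifold 𝓘(ℝ, E) ∞ X := by
  let := chartedSpace hi c hc
  refine isManifold_of_contDiffOn _ _ _ ?_
  rintro _ _ ⟨x, rfl⟩ ⟨y, rfl⟩
  have : ContDiffOn ℝ ∞ (fun w => (c y).coord (i ((c x).param w)))
      ((c x).target ∩ (c x).param ⁻¹' (i ⁻¹' (c y).source)) :=
    (c y).contDiffOn_coord.comp ((c x).contDiffOn_param.mono Set.inter_subset_left)
      fun w hw => hw.2
  refine this.mono ?_ |>.congr fun w _ => rfl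
  intro w hw
  have := hw.1
  exact this

theorem contMDiff_coe :
    letI := chartedSpace hi c hc
    ContMDiff 𝓘(ℝ, E) 𝓘(ℝ, V) ∞ i := by
  let := chartedSpace hi c hc
  intro x
  rw [contMDiffAt_iff_source]
  refine ContDiffWithinAt.contMDiffWithinAt ?_
  have h : (c x).coord (i x) ∈ (c x).target := (c x).coord_mem x (hc x)
  exact ((c x).contDiffOn_param.contDiffAt ((c x).isOpen_target.mem_nhds h)).contDiffWithinAt

/-- Charts are restrictions of smooth ambient maps and the topology is induced, so smoothness into
the submanifold can be checked in the ambient space. -/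
theorem contMDiffAt_of_coe {E' H' M : Type*} [NormedAddCommGroup E'] [NormedSpace ℝ E']
    [TopologicalSpace H'] {I' : ModelWithCorners ℝ E' H'} [TopologicalSpace M] [ChartedSpace H' M]
    {f : M → X} {p : M} (hf : ContMDiffAt I' 𝓘(ℝ, V) ∞ (i ∘ f) p) :
    letI := chartedSpace hi c hc
    ContMDiffAt I' 𝓘(ℝ, E) ∞ f p := by
  let := chartedSpace hi c hc
  rw [contMDiffAt_iff_target]
  refine ⟨hi.isInducing.continuousAt_iff.2 hf.continuousAt, ?_⟩
  have h := ((c (f p)).contDiffOn_coord.contDiffAt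
    ((c (f p)).isOpen_source.mem_nhds (hc (f p)))).contMDiffAt
  exact ContMDiffAt.comp (g := (c (f p)).coord) (f := i ∘ f) p h hf

end SmoothParam

/-- A map into the group of units of a complete normed algebra is smooth if it is so as a map into
the algebra. -/
theorem contMDiffAt_units {R E' H' M : Type*} [NormedRing R] [NormedAlgebra ℝ R] [CompleteSpace R]
    [NormedAddCommGroup E'] [NormedSpace ℝ E']
    [TopologicalSpace H'] {I' : ModelWithCorners ℝ E' H'} [TopologicalSpace M] [ChartedSpace H' M]
    {f : M → Rˣ} {p : M} (hf : ContMDiffAt I' 𝓘(ℝ, R) ∞ (fun x => (f x : R)) p) :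
    ContMDiffAt I' 𝓘(ℝ, R) ∞ f p := by
  rw [contMDiffAt_iff_target]
  exact ⟨Units.isOpenEmbedding_val.isInducing.continuousAt_iff.2 hf.continuousAt, hf⟩

end

section

/-! ### Block matrices and column reduction -/

section Blocks

variable {p q : ℕ}

theorem exists_castLE_or_le (h : q ≤ p) (k : Fin p) : (∃ a, k = Fin.castLE h a) ∨ q ≤ (k : ℕ) := by
  rcases lt_or_ge (k : ℕ) q with hk | hk
  · exact Or.inl ⟨⟨k, hk⟩, rfl⟩
  · exact Or.inr hk

/-- The splitting of `p` indices into the first `q` ones and the remaining ones. -/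
def blockEquiv (h : q ≤ p) : Fin q ⊕ Fin (p - q) ≃ Fin p :=
  finSumFinEquiv.trans (finCongr (Nat.add_sub_cancel' h))

theorem blockEquiv_inl (h : q ≤ p) (a : Fin q) : blockEquiv h (Sum.inl a) = Fin.castLE h a := rfl

theorem le_blockEquiv_inr (h : q ≤ p) (b : Fin (p - q)) :
    q ≤ (blockEquiv h (Sum.inr b) : ℕ) := by
  simp [blockEquiv]

theorem castLE_ne_inr (h : q ≤ p) (a : Fin q) (b : Fin (p - q)) :
    Fin.castLE h a ≠ blockEquiv h (Sum.inr b) := by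
  rw [← blockEquiv_inl]
  exact fun H => by simpa using (blockEquiv h).injective H

theorem exists_inr (h : q ≤ p) {k : Fin p} (hk : q ≤ (k : ℕ)) :
    ∃ b, k = blockEquiv h (Sum.inr b) := by
  obtain ⟨x, rfl⟩ := (blockEquiv h).surjective k
  rcases x with a | b
  · rw [blockEquiv_inl] at hk
    exact absurd (show (a : ℕ) < q from a.2) (not_lt.2 (by simpa using hk))
  · exact ⟨b, rfl⟩

/-- The square matrix with prescribed blocks. -/
def block (h : q ≤ p) (A : Matrix (Fin q) (Fin q) ℝ) (M : Matrix (Fin q) (Fin (p - q)) ℝ)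
    (N : Matrix (Fin (p - q)) (Fin q) ℝ) (B : Matrix (Fin (p - q)) (Fin (p - q)) ℝ) :
    Matrix (Fin p) (Fin p) ℝ :=
  Matrix.reindex (blockEquiv h) (blockEquiv h) (Matrix.fromBlocks A M N B)

variable (h : q ≤ p) (A : Matrix (Fin q) (Fin q) ℝ) (M : Matrix (Fin q) (Fin (p - q)) ℝ)
    (N : Matrix (Fin (p - q)) (Fin q) ℝ) (B : Matrix (Fin (p - q)) (Fin (p - q)) ℝ)

theorem block_castLE_castLE (a b : Fin q) :
    block h A M N B (Fin.castLE h a) (Fin.castLE h b) = A a b := by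
  simp [block, ← blockEquiv_inl]

theorem block_inr_castLE (a : Fin (p - q)) (b : Fin q) :
    block h A M N B (blockEquiv h (Sum.inr a)) (Fin.castLE h b) = N a b := by
  simp [block, ← blockEquiv_inl]

theorem isUnit_block_upper : IsUnit (block h A M 0 B) ↔ IsUnit A ∧ IsUnit B := by
  rw [block, Matrix.reindex_apply, Matrix.isUnit_submatrix_equiv, Matrix.isUnit_fromBlocks_zero₂₁]

theorem isUnit_block_lower : IsUnit (block h A 0 N B) ↔ IsUnit A ∧ IsUnit B := by
  rw [block, Matrix.reindex_apply, Matrix.isUnit_submatrix_equiv, Matrix.isUnit_fromBlocks_zero₁₂]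

theorem rank_block_zero_le : (block h A 0 0 0).rank ≤ A.rank := by
  have : Matrix.fromBlocks A 0 0 (0 : Matrix (Fin (p - q)) (Fin (p - q)) ℝ) =
      Matrix.fromRows (1 : Matrix (Fin q) (Fin q) ℝ) 0 * A *
        Matrix.fromCols (1 : Matrix (Fin q) (Fin q) ℝ) 0 := by
    rw [Matrix.fromRows_mul, Matrix.fromRows_mul_fromCols]
    simp
  rw [block, Matrix.rank_reindex, this]
  exact (Matrix.rank_mul_le_left _ _).trans (Matrix.rank_mul_le_right _ _)

theorem eq_block_upper (P : Matrix (Fin p) (Fin p) ℝ)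
    (hP : ∀ (k : Fin p) (a : Fin q), q ≤ (k : ℕ) → P k (Fin.castLE h a) = 0) :
    P = block h (P.submatrix (Fin.castLE h) (Fin.castLE h))
      (P.submatrix (Fin.castLE h) (blockEquiv h ∘ Sum.inr)) 0
      (P.submatrix (blockEquiv h ∘ Sum.inr) (blockEquiv h ∘ Sum.inr)) := by
  ext k l
  obtain ⟨k, rfl⟩ := (blockEquiv h).surjective k
  obtain ⟨l, rfl⟩ := (blockEquiv h).surjective l
  rcases k with k | k <;> rcases l with l | l <;> simp [block, ← blockEquiv_inl]
  rw [blockEquiv_inl]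
  exact hP _ _ (le_blockEquiv_inr h k)

theorem rank_le_of_forall_eq_zero {L : Type*} [Fintype L] (M : Matrix L (Fin p) ℝ) (h : q ≤ p)
    (hM : ∀ (l : L) (k : Fin p), q ≤ (k : ℕ) → M l k = 0) : M.rank ≤ q := by
  rw [← Matrix.rank_transpose]
  refine (Matrix.rank_le_card_of_support_subset M.transpose
    (Finset.univ.map (Fin.castLEEmb h)) ?_).trans (by simp)
  intro k hk
  rcases exists_castLE_or_le h k with ⟨a, rfl⟩ | hk'
  · simp
  · exact absurd (funext fun l => hM l k hk') hk

/-- Column reduction. -/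
theorem exists_isUnit_mul_transpose {L : Type*} [Fintype L] (M : Matrix L (Fin p) ℝ) (h : q ≤ p)
    (hM : M.rank = q) : ∃ P : Matrix (Fin p) (Fin p) ℝ, IsUnit P ∧
      ∀ (l : L) (k : Fin p), q ≤ (k : ℕ) → (M * P.transpose) l k = 0 := by
  classical
  set K := LinearMap.ker M.mulVecLin
  obtain ⟨C, hC⟩ := Submodule.exists_isCompl K
  have h1 : Module.finrank ℝ K = p - q := by
    have := M.mulVecLin.finrank_range_add_finrank_ker
    rw [Module.finrank_fin_fun] at this
    change M.rank + Module.finrank ℝ K = _ at this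
    omega
  have h2 : Module.finrank ℝ C = q := by
    have := Submodule.finrank_add_eq_of_isCompl hC
    rw [Module.finrank_fin_fun] at this
    omega
  -- A basis of a complement of the kernel comes first and one of the kernel last, so `M` kills the
  -- basis vectors from position `q` on.
  let b : Module.Basis (Fin p) ℝ (Fin p → ℝ) :=
    (((Module.finBasisOfFinrankEq ℝ C h2).prod (Module.finBasisOfFinrankEq ℝ K h1)).map
      (Submodule.prodEquivOfIsCompl C K hC.symm)).reindex (blockEquiv h)
  have hb : ∀ k : Fin p, q ≤ (k : ℕ) → b k ∈ K := by
    intro k hk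
    obtain ⟨k, rfl⟩ := exists_inr h hk
    simp [b]
  refine ⟨((Pi.basisFun ℝ (Fin p)).toMatrix b).transpose, ?_, ?_⟩
  · rw [Matrix.isUnit_transpose]
    let := (Pi.basisFun ℝ (Fin p)).invertibleToMatrix b
    exact isUnit_of_invertible _
  · intro l k hk
    have := congrFun (LinearMap.mem_ker.1 (hb k hk)) l
    simpa [Matrix.mul_apply, Matrix.mulVec, dotProduct, Module.Basis.toMatrix_apply] using this

end Blocks

/-! ### The base tensor and its multilinear rank -/

variable {m : ℕ} {n t : Fin (m + 1) → ℕ}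

theorem MatProd.isUnit_iff {A : MatProd n} : IsUnit A ↔ ∀ i, IsUnit (A i) :=
  Pi.isUnit_iff (M := fun i => Matrix (Fin (n i)) (Fin (n i)) ℝ) (x := A)

theorem GLProd.inv_mul_apply (g : GLProd n) (i : Fin (m + 1)) :
    ((g⁻¹ : GLProd n) : MatProd n) i * (g : MatProd n) i = 1 := by
  rw [← MatProd.mul_apply, g.inv_mul, MatProd.one_apply]

/-- The tuple with entry `P` in position `i`, and identity matrices elsewhere. -/
def single (i : Fin (m + 1)) (P : Matrix (Fin (n i)) (Fin (n i)) ℝ) : MatProd n :=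
  Function.update (1 : ∀ j, Matrix (Fin (n j)) (Fin (n j)) ℝ) i P

theorem single_same (i : Fin (m + 1)) (P : Matrix (Fin (n i)) (Fin (n i)) ℝ) :
    single i P i = P := Function.update_self ..

theorem single_of_ne {i j : Fin (m + 1)} (P : Matrix (Fin (n i)) (Fin (n i)) ℝ) (h : j ≠ i) :
    single i P j = 1 := Function.update_of_ne h ..

theorem isUnit_single {i : Fin (m + 1)} {P : Matrix (Fin (n i)) (Fin (n i)) ℝ} (h : IsUnit P) :
    IsUnit (single i P) := by
  refine MatProd.isUnit_iff.2 fun j => ?_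
  by_cases hj : j = i
  · subst hj; rwa [single_same]
  · rw [single_of_ne _ hj]; exact isUnit_one

theorem single_one (i : Fin (m + 1)) : single i (1 : Matrix (Fin (n i)) (Fin (n i)) ℝ) = 1 :=
  Function.update_eq_self i (1 : ∀ j, Matrix (Fin (n j)) (Fin (n j)) ℝ)

variable (e : Fin (t 0) ≃ ∀ j : Fin m, Fin (t j.succ))

/-- The multi-indices `(a, e a)`, at which the core tensor is nonzero. -/
def idx (a : Fin (t 0)) : ∀ i, Fin (t i) := Fin.cons a (e a)

theorem idx_succ (a : Fin (t 0)) (j : Fin m) : idx e a j.succ = e a j := rfl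

/-- Without coordinate 0, injectivity of `e` recovers `a`; without any other one, coordinate 0 is
still `a`. Hence a line through a support point in any mode meets no other support point. -/
theorem idx_injective_succAbove {i : Fin (m + 1)} {a b : Fin (t 0)}
    (h : ∀ j, idx e a (i.succAbove j) = idx e b (i.succAbove j)) : a = b := by
  by_cases hi : i = 0
  · subst hi
    exact e.injective (funext fun j => h j)
  · obtain ⟨j, hj⟩ := Fin.exists_succAbove_eq (Ne.symm hi)
    have := h j
    rw [hj] at this
    exact this

/-- Positivity is needed to fill the remaining coordinates; if all `t i` vanish there is no `β`. -/
theorem exists_idx_eq (ht₀ : (∀ i, 1 ≤ t i) ∨ ∀ i, t i = 0) (i : Fin (m + 1)) (β : Fin (t i)) :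
    ∃ a, idx e a i = β := by
  have h1 : ∀ i, 1 ≤ t i := ht₀.resolve_right fun h => by
    have := h i ▸ β
    exact Fin.elim0 this
  induction i using Fin.cases with
  | zero => exact ⟨β, rfl⟩
  | succ j =>
    classical
    refine ⟨e.symm (Function.update (fun j => ⟨0, h1 j.succ⟩) j β), ?_⟩
    rw [idx_succ, e.apply_symm_apply, Function.update_self]

variable (ht : ∀ i, t i ≤ n i)

/-- The inclusion of the multi-indices of the core. -/
def inc (α : ∀ i, Fin (t i)) : ∀ i, Fin (n i) := fun i => Fin.castLE (ht i) (α i)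

theorem baseTensor_apply (k : ∀ i, Fin (n i)) :
    baseTensor n e k = ∑ a, ∏ i, if inc ht (idx e a) i = k i then 1 else 0 := by
  classical
  rw [baseTensor, ← (Fin.consEquiv fun i => Fin (t i)).sum_comp, Fintype.sum_prod_type]
  refine Finset.sum_congr rfl fun a _ => ?_
  rw [Finset.sum_eq_single (e a)]
  · change (if e a = e a then (1 : ℝ) else 0) * _ = _
    rw [if_pos rfl, one_mul]
    refine Finset.prod_congr rfl fun i _ => if_congr ?_ rfl rfl
    rw [Fin.ext_iff, eq_comm]
    rfl
  · intro b _ hb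
    exact mul_eq_zero_of_left (if_neg hb.symm) _
  · simp

/-- Only the first `t i` columns of each factor meet the base tensor, which is why the right-hand
blocks of a stabilizer element are free. -/
theorem act_baseTensor (A : MatProd n) (k : ∀ i, Fin (n i)) :
    act A (baseTensor n e) k = ∑ a, ∏ i, A i (k i) (inc ht (idx e a) i) := by
  simp only [act, baseTensor_apply e ht, Finset.mul_sum, ← Finset.prod_mul_distrib]
  rw [Finset.sum_comm]
  refine Finset.sum_congr rfl fun a _ => ?_
  refine (Fintype.prod_sum
    (fun i l => A i (k i) l * if inc ht (idx e a) i = l then 1 else 0)).symm.trans ?_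
  simp

theorem act_baseTensor_succ (A : MatProd n) (k : ∀ i, Fin (n i)) :
    act A (baseTensor n e) k = ∑ a, A 0 (k 0) (Fin.castLE (ht 0) a) *
      ∏ j : Fin m, A j.succ (k j.succ) (Fin.castLE (ht j.succ) (e a j)) := by
  simp only [act_baseTensor e ht, Fin.prod_univ_succ]
  rfl

/-- With the other coordinates fixed at those of a support point, only that support point
contributes, so a column of `P` can be read off. -/
theorem act_single_baseTensor (i : Fin (m + 1)) (P : Matrix (Fin (n i)) (Fin (n i)) ℝ)
    (k : Fin (n i)) (a : Fin (t 0)) :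
    act (single i P) (baseTensor n e)
      (i.insertNth k fun j => inc ht (idx e a) (i.succAbove j)) =
      P k (inc ht (idx e a) i) := by
  rw [act_baseTensor e ht, Finset.sum_eq_single a]
  · simp [Fin.prod_univ_succAbove _ i, single_same, single_of_ne]
  · intro b _ hb
    obtain ⟨j, hj⟩ : ∃ j, idx e a (i.succAbove j) ≠ idx e b (i.succAbove j) := by
      by_contra! H
      exact hb (idx_injective_succAbove e H).symm
    refine Finset.prod_eq_zero (Finset.mem_univ (i.succAbove j)) ?_
    rw [single_of_ne _ (Fin.succAbove_ne i j), Fin.insertNth_apply_succAbove,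
      Matrix.one_apply_ne]
    simpa [inc] using hj
  · simp

theorem baseTensor_insertNth (i : Fin (m + 1)) (k : Fin (n i)) (a : Fin (t 0)) :
    baseTensor n e (i.insertNth k fun j => inc ht (idx e a) (i.succAbove j)) =
      if k = inc ht (idx e a) i then 1 else 0 := by
  rw [← Matrix.one_apply, ← act_single_baseTensor e ht i 1 k a, single_one, act_one]

theorem baseTensor_eq_zero {k : ∀ i, Fin (n i)} {i : Fin (m + 1)} (hk : t i ≤ (k i : ℕ)) :
    baseTensor n e k = 0 := by
  rw [baseTensor]
  refine Finset.sum_eq_zero fun α _ => mul_eq_zero_of_right _ ?_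
  refine Finset.prod_eq_zero (Finset.mem_univ i) (if_neg ?_)
  have := (α i).2
  omega

include ht in
theorem mrank_baseTensor (ht₀ : (∀ i, 1 ≤ t i) ∨ ∀ i, t i = 0) : mrank (baseTensor n e) = t := by
  funext i
  refine le_antisymm ?_ ?_
  · refine rank_le_of_forall_eq_zero _ (ht i) fun l k hk => ?_
    exact baseTensor_eq_zero e (i := i) (by simpa using hk)
  -- One support point for each index `β` of mode `i` selects a row of the unfolding; these rows
  -- contain an identity matrix of size `t i`.
  · choose a ha using exists_idx_eq e ht₀ i
    have : (unfolding (baseTensor n e) i).submatrix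
        (fun β j => inc ht (idx e (a β)) (i.succAbove j)) (Fin.castLE (ht i)) = 1 := by
      ext β γ
      rw [unfolding, Matrix.submatrix_apply, Matrix.of_apply, baseTensor_insertNth,
        Matrix.one_apply, inc, ha]
      exact if_congr (by rw [Fin.castLE_inj, eq_comm]) rfl rfl
    calc t i = (1 : Matrix (Fin (t i)) (Fin (t i)) ℝ).rank := by simp
      _ ≤ _ := this ▸ Matrix.rank_submatrix_le _ _ _

include ht in
theorem baseTensor_mem (ht₀ : (∀ i, 1 ≤ t i) ∨ ∀ i, t i = 0) :
    baseTensor n e ∈ mrankSet n t := mrank_baseTensor e ht ht₀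

/-- The factors outside mode `i` only recombine rows of the mode-`i` unfolding, so zero columns stay
zero. -/
theorem act_eq_zero {A : MatProd n} {T : Tensor n} {i : Fin (m + 1)}
    (h : ∀ l (k : Fin (n i)), t i ≤ (k : ℕ) → (unfolding T i * (A i).transpose) l k = 0)
    {k : ∀ i, Fin (n i)} (hk : t i ≤ (k i : ℕ)) : act A T k = 0 := by
  have h1 : act A T k = unfolding (act A T) i (fun j => k (i.succAbove j)) (k i) := by
    rw [unfolding, Matrix.of_apply]
    congr 1
    exact (Fin.insertNth_self_removeNth i k).symm
  rw [h1, unfolding_act, Matrix.mul_assoc, Matrix.mul_apply]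
  exact Finset.sum_eq_zero fun l _ => by rw [h l _ hk, mul_zero]

theorem apply_castLE_eq_zero (ht₀ : (∀ i, 1 ≤ t i) ∨ ∀ i, t i = 0) (g : GLProd n)
    {i : Fin (m + 1)}
    (h : ∀ k : ∀ i, Fin (n i), t i ≤ (k i : ℕ) → (g • baseTensor n e) k = 0) (k : Fin (n i))
    (β : Fin (t i)) (hk : t i ≤ (k : ℕ)) : (g : MatProd n) i k (Fin.castLE (ht i) β) = 0 := by
  obtain ⟨a, rfl⟩ := exists_idx_eq e ht₀ i β
  -- Undoing `g` in every mode except `i` keeps the zeros in mode `i` and leaves `g i` acting alone,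
  -- where its entries are visible.
  let g' : MatProd n := Function.update
    (((g⁻¹ : GLProd n) : MatProd n) : ∀ j, Matrix (Fin (n j)) (Fin (n j)) ℝ) i 1
  have hg' : g' * (g : MatProd n) = single i ((g : MatProd n) i) := by
    funext j
    rw [MatProd.mul_apply]
    by_cases hj : j = i
    · subst hj
      rw [single_same, show g' j = 1 from Function.update_self .., one_mul]
    · rw [single_of_ne _ hj, show g' j = ((g⁻¹ : GLProd n) : MatProd n) j from
        Function.update_of_ne hj .., GLProd.inv_mul_apply]
  have h1 := act_single_baseTensor e ht i ((g : MatProd n) i) k a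
  rw [← hg', act_mul] at h1
  refine Eq.trans h1.symm (act_eq_zero (t := t) (i := i) (fun l k hk => ?_) (by simpa using hk))
  rw [show g' i = 1 from Function.update_self .., Matrix.transpose_one, Matrix.mul_one]
  exact h _ (by simpa using hk)

/-! ### Kronecker products and the stabilizer -/

theorem kron_mul (X Y : ∀ j : Fin m, Matrix (Fin (t j.succ)) (Fin (t j.succ)) ℝ) :
    kron e X * kron e Y = kron e fun j => X j * Y j := by
  ext a b
  simp only [kron, Matrix.mul_apply, Matrix.of_apply, ← Finset.prod_mul_distrib]
  rw [e.sum_comp (fun c => ∏ j, X j (e a j) (c j) * Y j (c j) (e b j))]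
  exact (Fintype.prod_sum fun j l => X j (e a j) l * Y j l (e b j)).symm

theorem kron_one : kron e (fun _ => 1) = 1 := by
  ext a b
  by_cases h : a = b
  · subst h; simp [kron]
  · obtain ⟨j, hj⟩ := Function.ne_iff.1 (e.injective.ne h)
    rw [Matrix.one_apply_ne h]
    exact Finset.prod_eq_zero (Finset.mem_univ j) (Matrix.one_apply_ne hj)

theorem kron_transpose (X : ∀ j : Fin m, Matrix (Fin (t j.succ)) (Fin (t j.succ)) ℝ) :
    (kron e X).transpose = kron e fun j => (X j).transpose := rfl

/-- The upper left block of the entry `i`. -/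
def corner (A : MatProd n) (i : Fin (m + 1)) : Matrix (Fin (t i)) (Fin (t i)) ℝ :=
  (A i).submatrix (Fin.castLE (ht i)) (Fin.castLE (ht i))

/-- Read through `e`, the sum over support points is a matrix product. -/
theorem act_baseTensor_inc (A : MatProd n) (a b : Fin (t 0)) :
    act A (baseTensor n e) (inc ht (Fin.cons a (e b))) =
      (corner ht A 0 * (kron e fun j => corner ht A j.succ).transpose) a b := by
  rw [act_baseTensor_succ e ht, Matrix.mul_apply]
  rfl

theorem baseTensor_inc (a b : Fin (t 0)) :
    baseTensor n e (inc ht (Fin.cons a (e b))) = (1 : Matrix (Fin (t 0)) (Fin (t 0)) ℝ) a b := by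
  have h := act_baseTensor_inc e ht 1 a b
  have h1 : ∀ i, corner ht (1 : MatProd n) i = 1 := fun i => by
    rw [corner, MatProd.one_apply]
    exact Matrix.submatrix_one_embedding (Fin.castLEEmb (ht i))
  rw [act_one] at h
  simpa only [h1, kron_one, Matrix.transpose_one, Matrix.mul_one] using h

include ht in
theorem eq_of_apply_inc {T T' : Tensor n}
    (h : ∀ a b, T (inc ht (Fin.cons a (e b))) = T' (inc ht (Fin.cons a (e b))))
    (hT : ∀ k i, t i ≤ (k i : ℕ) → T k = 0) (hT' : ∀ k i, t i ≤ (k i : ℕ) → T' k = 0) :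
    T = T' := by
  funext k
  by_cases H : ∃ i, t i ≤ (k i : ℕ)
  · obtain ⟨i, hi⟩ := H
    rw [hT k i hi, hT' k i hi]
  · push Not at H
    have : k = inc ht (Fin.cons ⟨k 0, H 0⟩ (e (e.symm fun j => ⟨k j.succ, H j.succ⟩))) := by
      rw [e.apply_symm_apply]
      funext i
      induction i using Fin.cases <;> rfl
    rw [this]
    exact h _ _

theorem stabilizer_eq (ht₀ : (∀ i, 1 ≤ t i) ∨ ∀ i, t i = 0) :
    (MulAction.stabilizer (GLProd n) (baseTensor n e) : Set (GLProd n)) =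
      stabilizerForm ht e := by
  ext g
  rw [SetLike.mem_coe, MulAction.mem_stabilizer_iff]
  constructor
  · intro hg
    have hz := fun i => eq_block_upper (ht i) ((g : MatProd n) i) fun k β hk =>
      apply_castLE_eq_zero e ht ht₀ g (fun k hk => by
        rw [hg]; exact baseTensor_eq_zero e hk) k β hk
    have hu := fun i => (isUnit_block_upper (ht i) _ _ _).1
      (hz i ▸ MatProd.isUnit_iff.1 g.isUnit i)
    have hK : corner ht (g : MatProd n) 0 *
        (kron e fun j => corner ht (g : MatProd n) j.succ).transpose = 1 := by
      ext a b
      rw [← act_baseTensor_inc, ← baseTensor_inc e ht]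
      exact congrFun hg _
    -- The corner in mode 0 and the Kronecker product of the inverse transposes both invert the same
    -- matrix, so they agree.
    have hK' : kron e (fun j => (((hu j.succ).1.unit⁻¹ :
        GL (Fin (t j.succ)) ℝ).val.transpose)) *
        (kron e fun j => corner ht (g : MatProd n) j.succ).transpose = 1 := by
      rw [kron_transpose, kron_mul, ← kron_one e]
      congr 1
      funext j
      rw [← Matrix.transpose_mul]
      exact (congrArg Matrix.transpose (hu j.succ).1.unit.mul_inv).trans Matrix.transpose_one
    refine ⟨fun j => (hu j.succ).1.unit, fun i => (hu i).2.unit,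
      fun i => ((g : MatProd n) i).submatrix (Fin.castLE (ht i)) (blockEquiv (ht i) ∘ Sum.inr),
      ?_, fun j => hz j.succ⟩
    rw [left_inv_eq_right_inv hK' (mul_eq_one_comm.1 hK)]
    exact hz 0
  · rintro ⟨A, B, M, h0, hs⟩
    have hb : ∀ i, ∃ A, (g : MatProd n) i = block (ht i) A (M i) 0 (B i) := fun i => by
      induction i using Fin.cases with
      | zero => exact ⟨_, h0⟩
      | succ j => exact ⟨_, hs j⟩
    refine eq_of_apply_inc e ht (fun a b => ?_) (fun k i hk => ?_) fun k i hk =>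
      baseTensor_eq_zero e hk
    · refine (act_baseTensor_inc e ht _ a b).trans ?_
      have h1 : corner ht (g : MatProd n) 0 =
          kron e fun j => ((A j)⁻¹ : GL (Fin (t j.succ)) ℝ).val.transpose := by
        ext a b
        rw [corner, h0]
        exact block_castLE_castLE (ht 0) _ _ _ _ a b
      have h2 : ∀ j : Fin m, corner ht (g : MatProd n) j.succ = A j := fun j => by
        ext a b
        rw [corner, hs j]
        exact block_castLE_castLE (ht j.succ) _ _ _ _ a b
      simp only [h1, h2, baseTensor_inc, kron_transpose, kron_mul, ← Matrix.transpose_mul,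
        Units.mul_inv, Matrix.transpose_one, kron_one]
    · refine (act_baseTensor e ht _ k).trans (Finset.sum_eq_zero fun a _ => ?_)
      refine Finset.prod_eq_zero (Finset.mem_univ i) ?_
      obtain ⟨A, hA⟩ := hb i
      obtain ⟨b, hb⟩ := exists_inr (ht i) hk
      rw [hA, hb]
      exact block_inr_castLE ..

end

/-! ### Transitivity and normal forms -/

section

theorem block_mul_block_diag {p q : ℕ} (h : q ≤ p) (A U : Matrix (Fin q) (Fin q) ℝ)
    (N : Matrix (Fin (p - q)) (Fin q) ℝ) :
    block h A 0 N 1 * block h U 0 0 1 = block h (A * U) 0 (N * U) 1 := by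
  simp [block, Matrix.submatrix_mul_equiv, Matrix.fromBlocks_multiply]

variable {m : ℕ} {n t : Fin (m + 1) → ℕ} (e : Fin (t 0) ≃ ∀ j : Fin m, Fin (t j.succ))
  (ht : ∀ i, t i ≤ n i)

theorem act_baseTensor_congr {A A' : MatProd n}
    (h : ∀ i k β, A i k (Fin.castLE (ht i) β) = A' i k (Fin.castLE (ht i) β)) :
    act A (baseTensor n e) = act A' (baseTensor n e) := by
  funext k
  simp only [act_baseTensor e ht, inc, h]

theorem act_baseTensor_eq_zero {A : MatProd n} {k : ∀ i, Fin (n i)} {i : Fin (m + 1)}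
    (h : ∀ β, A i (k i) (Fin.castLE (ht i) β) = 0) : act A (baseTensor n e) k = 0 := by
  rw [act_baseTensor e ht]
  exact Finset.sum_eq_zero fun a _ => Finset.prod_eq_zero (Finset.mem_univ i) (h _)

/-- The core of a tensor, as a square matrix. -/
def core (T : Tensor n) : Matrix (Fin (t 0)) (Fin (t 0)) ℝ :=
  Matrix.of fun a b => T (inc ht (Fin.cons a (e b)))

theorem core_act_baseTensor (A : MatProd n) :
    core e ht (act A (baseTensor n e)) =
      corner ht A 0 * (kron e fun j => corner ht A j.succ).transpose := by
  ext a b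
  exact act_baseTensor_inc e ht A a b

theorem corner_of_eq_block {A : MatProd n} {i : Fin (m + 1)} {C M N B}
    (h : A i = block (ht i) C M N B) : corner ht A i = C := by
  ext a b
  rw [corner, h]
  exact block_castLE_castLE (ht i) C M N B a b

theorem corner_one (i : Fin (m + 1)) : corner ht (1 : MatProd n) i = 1 := by
  rw [corner, MatProd.one_apply]
  exact Matrix.submatrix_one_embedding (Fin.castLEEmb (ht i))

theorem corner_single_zero_succ (P : Matrix (Fin (n 0)) (Fin (n 0)) ℝ) (j : Fin m) :
    corner ht (single 0 P : MatProd n) j.succ = 1 := by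
  rw [← corner_one ht, corner, corner, single_of_ne _ (Fin.succ_ne_zero j), MatProd.one_apply]

/-- The base core is the identity, so mode 0 alone produces any core. The block `B` never meets the
base tensor: `B = 0` serves to bound a rank, `B = 1` to get a group element. -/
theorem eq_act_single_block {T : Tensor n} (hT : ∀ k i, t i ≤ (k i : ℕ) → T k = 0)
    (B : Matrix (Fin (n 0 - t 0)) (Fin (n 0 - t 0)) ℝ) :
    T = act (single 0 (block (ht 0) (core e ht T) 0 0 B)) (baseTensor n e) := by
  refine eq_of_apply_inc e ht (fun a b => ?_) hT fun k i hk =>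
    act_baseTensor_eq_zero e ht (i := i) fun β => ?_
  · rw [act_baseTensor_inc e ht, corner_of_eq_block ht (single_same 0 _)]
    simp only [corner_single_zero_succ, kron_one, Matrix.transpose_one, Matrix.mul_one]
    rfl
  · obtain ⟨b, hb⟩ := exists_inr (ht i) hk
    by_cases hi : i = 0
    · subst hi
      rw [single_same, hb]
      exact block_inr_castLE ..
    · rw [single_of_ne _ hi, hb]
      exact Matrix.one_apply_ne (castLE_ne_inr _ _ _).symm

include ht in
theorem exists_smul_baseTensor_eq {T : Tensor n} (hT : T ∈ mrankSet n t) :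
    ∃ g : GLProd n, g • baseTensor n e = T := by
  choose P hP hPT using fun i => exists_isUnit_mul_transpose (unfolding T i) (ht i)
    (congrFun (show mrank T = t from hT) i)
  -- All modes can be reduced at once, since by `act_eq_zero` the other factors preserve the zeros
  -- created in mode `i`.
  obtain ⟨p, hp⟩ := MatProd.isUnit_iff.2 hP
  have hz : ∀ (k : ∀ i, Fin (n i)) i, t i ≤ (k i : ℕ) → (p • T) k = 0 := fun k i hk =>
    act_eq_zero (t := t) (i := i) (hp ▸ hPT i) hk
  have hr : t 0 ≤ (core e ht (p • T)).rank := by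
    have h1 : mrank (p • T) 0 = t 0 := by
      rw [mrank_smul]; exact congrFun (show mrank T = t from hT) 0
    -- The mode-0 unfolding now has the padded core as a factor, so its rank `t 0` is at most that
    -- of the core.
    rw [eq_act_single_block e ht hz 0, mrank, unfolding_act, single_same] at h1
    have h2 := Matrix.rank_mul_le_right ((Matrix.of fun (l l' : ∀ j : Fin m,
      Fin (n ((0 : Fin (m + 1)).succAbove j))) => ∏ j, single 0 (block (ht 0)
        (core e ht (p • T)) 0 0 0) ((0 : Fin (m + 1)).succAbove j) (l j) (l' j)) *
        unfolding (baseTensor n e) 0) (block (ht 0) (core e ht (p • T)) 0 0 0).transpose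
    rw [h1, Matrix.rank_transpose] at h2
    exact h2.trans (rank_block_zero_le _ _)
  have hu : IsUnit (core e ht (p • T)) := by
    rw [← Matrix.mulVec_surjective_iff_isUnit]
    refine (LinearMap.range_eq_top (f := (core e ht (p • T)).mulVecLin)).1 ?_
    refine Submodule.eq_top_of_finrank_eq (le_antisymm (Submodule.finrank_le _) ?_)
    rw [Module.finrank_fin_fun]
    exact hr
  obtain ⟨q, hq⟩ := isUnit_single (n := n) (i := 0)
    ((isUnit_block_upper (ht 0) (core e ht (p • T)) 0 1).2 ⟨hu, isUnit_one⟩)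
  refine ⟨p⁻¹ * q, ?_⟩
  rw [mul_smul, inv_smul_eq_iff]
  conv_rhs => rw [eq_act_single_block e ht hz 1, ← hq]
  rfl

include e ht in
theorem isPretransitive (ht₀ : (∀ i, 1 ≤ t i) ∨ ∀ i, t i = 0) :
    MulAction.IsPretransitive (GLProd n) (mrankSet n t) := by
  refine (MulAction.isPretransitive_iff_base
    (⟨baseTensor n e, baseTensor_mem e ht ht₀⟩ : mrankSet n t)).2 ?_
  rintro ⟨T, hT⟩
  obtain ⟨g, hg⟩ := exists_smul_baseTensor_eq e ht hT
  exact ⟨g, Subtype.ext hg⟩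

/-- A kernel vector `v` of `U j`, tensored with standard basis vectors in the other positions, lies
in the kernel of the Kronecker product. Its coordinate at `b` is `v β`, which must vanish. -/
theorem isUnit_of_isUnit_kron (ht₀ : (∀ i, 1 ≤ t i) ∨ ∀ i, t i = 0)
    {U : ∀ j : Fin m, Matrix (Fin (t j.succ)) (Fin (t j.succ)) ℝ} (hU : IsUnit (kron e U))
    (j : Fin m) : IsUnit (U j) := by
  classical
  rw [← Matrix.mulVec_injective_iff_isUnit] at hU ⊢
  refine (injective_iff_map_eq_zero (U j).mulVecLin).2 fun v hv => funext fun β => ?_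
  obtain ⟨b, hb⟩ := exists_idx_eq e ht₀ j.succ β
  rw [idx_succ] at hb
  let V : ∀ j : Fin m, Fin (t j.succ) → ℝ :=
    Function.update (fun j => Pi.single (e b j) 1) j v
  have hV : V j = v := Function.update_self ..
  have h1 : (kron e U).mulVec (fun a => ∏ j, V j (e a j)) = 0 := by
    funext a
    have h2 : (kron e U).mulVec (fun a => ∏ j, V j (e a j)) a =
        ∏ j, (U j).mulVec (V j) (e a j) := by
      simp only [kron, Matrix.mulVec, dotProduct, Matrix.of_apply, ← Finset.prod_mul_distrib]
      rw [e.sum_comp (fun c => ∏ j, U j (e a j) (c j) * V j (c j))]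
      exact (Fintype.prod_sum fun j l => U j (e a j) l * V j l).symm
    rw [h2]
    refine Finset.prod_eq_zero (Finset.mem_univ j) ?_
    rw [hV]
    exact congrFun hv _
  have h2 := congrFun (hU (h1.trans (Matrix.mulVec_zero _).symm)) b
  rw [Finset.prod_eq_single j] at h2
  · rw [hV, hb] at h2
    exact h2
  · intro j' _ hj'
    simp [V, Function.update_of_ne hj']
  · simp

/-- The parameter space of the charts. -/
abbrev Param (n t : Fin (m + 1) → ℕ) : Type :=
  (Fin (t 0) → Fin (t 0) → ℝ) × ∀ i, Fin (n i - t i) → Fin (t i) → ℝ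

/-- The upper left blocks of `frame`. -/
def frameCorner (w : Param n t) : ∀ i, Matrix (Fin (t i)) (Fin (t i)) ℝ :=
  Fin.cases (Matrix.of w.1) fun _ => 1

/-- The tuple of matrices `[A 0; X 0 1] × [1 0; X 1 1] × ⋯ × [1 0; X m 1]` with parameters
`(A, X)`. -/
def frame (w : Param n t) : MatProd n :=
  fun i => block (ht i) (frameCorner w i) 0 (Matrix.of (w.2 i)) 1

theorem isUnit_frame {w : Param n t} (hw : IsUnit (Matrix.of w.1)) : IsUnit (frame ht w) := by
  refine MatProd.isUnit_iff.2 fun i => (isUnit_block_lower (ht i) _ _ _).2 ⟨?_, isUnit_one⟩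
  induction i using Fin.cases with
  | zero => exact hw
  | succ j => exact isUnit_one

theorem core_frame (w : Param n t) :
    core e ht (act (frame ht w) (baseTensor n e)) = Matrix.of w.1 := by
  rw [core_act_baseTensor, corner_of_eq_block ht (A := frame ht w) (i := 0) rfl]
  have : ∀ j : Fin m, corner ht (frame ht w) j.succ = 1 := fun j => corner_of_eq_block ht rfl
  simp only [this, kron_one, Matrix.transpose_one, Matrix.mul_one]
  rfl

/-- An invertible core makes every corner in modes `j.succ` invertible. These corners define a block
diagonal stabilizer element `d`, and `frame * d` has the same first `t i` columns as `g` in each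
mode `i`, which is all that the base tensor sees. -/
theorem exists_frame (ht₀ : (∀ i, 1 ≤ t i) ∨ ∀ i, t i = 0) {T : Tensor n}
    (hT : T ∈ mrankSet n t) (hu : IsUnit (core e ht T)) :
    ∃ w : Param n t, act (frame ht w) (baseTensor n e) = T := by
  obtain ⟨g, rfl⟩ := exists_smul_baseTensor_eq e ht hT
  change IsUnit (core e ht (act g (baseTensor n e))) at hu
  rw [core_act_baseTensor] at hu
  have hk := isUnit_of_mul_isUnit_right hu
  rw [Matrix.isUnit_transpose] at hk
  choose U hU using isUnit_of_isUnit_kron e ht₀ hk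
  let u : ∀ i, Matrix (Fin (t i)) (Fin (t i)) ℝ :=
    Fin.cases (kron e fun j => ((U j)⁻¹ : GL (Fin (t j.succ)) ℝ).val.transpose) fun j => U j
  have hK : (kron e fun j => corner ht (g : MatProd n) j.succ).transpose * u 0 = 1 := by
    change Matrix.transpose _ * kron e _ = 1
    rw [kron_transpose, kron_mul, ← kron_one e]
    congr 1
    funext j
    rw [← Matrix.transpose_mul, ← hU, Units.inv_mul, Matrix.transpose_one]
  have hu' : ∀ i, IsUnit (u i) := fun i => by
    induction i using Fin.cases with
    | zero => exact IsUnit.of_mul_eq_one _ (mul_eq_one_comm.1 hK)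
    | succ j => exact (U j).isUnit
  let D : MatProd n := fun i => block (ht i) (u i) 0 0 1
  obtain ⟨d, hd⟩ : IsUnit D :=
    MatProd.isUnit_iff.2 fun i => (isUnit_block_upper (ht i) _ _ _).2 ⟨hu' i, isUnit_one⟩
  have hd' : d ∈ stabilizerForm ht e :=
    ⟨U, fun _ => 1, fun _ => 0, by rw [hd]; rfl, fun j => by rw [hd]; rfl⟩
  rw [← stabilizer_eq e ht ht₀] at hd'
  have hd'' : act (d : MatProd n) (baseTensor n e) = baseTensor n e := hd'
  let w : Param n t := (corner ht (g : MatProd n) 0 *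
      (kron e fun j => corner ht (g : MatProd n) j.succ).transpose,
    fun i => ((g : MatProd n) i).submatrix (blockEquiv (ht i) ∘ Sum.inr) (Fin.castLE (ht i)) *
      (u i)⁻¹)
  refine ⟨w, ?_⟩
  conv_lhs => rw [← hd'', ← act_mul]
  refine act_baseTensor_congr e ht fun i k β => ?_
  have h1 : (frame ht w * (d : MatProd n)) i = block (ht i) (corner ht (g : MatProd n) i) 0
      (((g : MatProd n) i).submatrix (blockEquiv (ht i) ∘ Sum.inr) (Fin.castLE (ht i))) 1 := by
    rw [MatProd.mul_apply, hd]
    refine (block_mul_block_diag (ht i) _ _ _).trans ?_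
    congr 1
    · induction i using Fin.cases with
      | zero =>
        change corner ht (g : MatProd n) 0 * _ * _ = _
        rw [Matrix.mul_assoc, hK, Matrix.mul_one]
      | succ j =>
        change (1 : Matrix (Fin (t j.succ)) (Fin (t j.succ)) ℝ) * (U j).val = _
        rw [one_mul, hU]
    · change ((g : MatProd n) i).submatrix (blockEquiv (ht i) ∘ Sum.inr)
        (Fin.castLE (ht i)) * (u i)⁻¹ * u i = _
      rw [Matrix.mul_assoc, Matrix.nonsing_inv_mul _ ((Matrix.isUnit_iff_isUnit_det _).1 (hu' i)),
        Matrix.mul_one]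
  rw [h1]
  rcases exists_castLE_or_le (ht i) k with ⟨a, rfl⟩ | hk
  · rw [block_castLE_castLE]; rfl
  · obtain ⟨b, rfl⟩ := exists_inr (ht i) hk
    rw [block_inr_castLE]; rfl

/-- The lower blocks of the frame of a tensor. The index `b j β` is such that its image under `e`
has entry `β` in position `j`. -/
def lowerBlock (b : ∀ j : Fin m, Fin (t j.succ) → Fin (t 0)) (T : Tensor n) :
    ∀ i, Fin (n i - t i) → Fin (t i) → ℝ :=
  Fin.cases (fun k c => T (Fin.cons (blockEquiv (ht 0) (Sum.inr k))
      fun j => Fin.castLE (ht j.succ) (e c j)))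
    fun j k β => ∑ a, (core e ht T)⁻¹ (b j β) a *
      T (Function.update (inc ht (Fin.cons a (e (b j β)))) j.succ
        (blockEquiv (ht j.succ) (Sum.inr k)))

/-- In mode 0 the entries outside the core are the parameters themselves. In mode `j.succ` the slice
is the core times a vector `F`; inverting the core isolates `F (b j β)`, whose factors are the
parameter and diagonal entries of identity matrices. -/
theorem lowerBlock_frame {b : ∀ j : Fin m, Fin (t j.succ) → Fin (t 0)}
    (hb : ∀ j β, e (b j β) j = β) {w : Param n t} (hw : IsUnit (Matrix.of w.1)) :
    lowerBlock e ht b (act (frame ht w) (baseTensor n e)) = w.2 := by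
  funext i
  induction i using Fin.cases with
  | zero =>
    funext k c
    change act (frame ht w) (baseTensor n e) _ = _
    rw [act_baseTensor_succ e ht, Finset.sum_eq_single c]
    · simp only [Fin.cons_zero, Fin.cons_succ, frame]
      rw [block_inr_castLE, Finset.prod_eq_one, mul_one]
      · rfl
      · intro j _
        rw [block_castLE_castLE]
        exact Matrix.one_apply_eq _
    · intro a _ ha
      obtain ⟨j, hj⟩ := Function.ne_iff.1 (e.injective.ne ha)
      refine mul_eq_zero_of_right _ (Finset.prod_eq_zero (Finset.mem_univ j) ?_)
      simp only [Fin.cons_succ, frame]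
      rw [block_castLE_castLE]
      exact Matrix.one_apply_ne hj.symm
    · simp
  | succ j =>
    funext k β
    change ∑ a, (core e ht _)⁻¹ (b j β) a * act (frame ht w) (baseTensor n e) _ = _
    rw [core_frame]
    set A : Matrix (Fin (t 0)) (Fin (t 0)) ℝ := Matrix.of w.1
    let F : Fin (t 0) → ℝ := fun c => ∏ j' : Fin m, frame ht w j'.succ
      (Function.update (inc ht (Fin.cons c (e (b j β)))) j.succ
        (blockEquiv (ht j.succ) (Sum.inr k)) j'.succ) (Fin.castLE (ht j'.succ) (e c j'))
    have h1 : ∀ a, act (frame ht w) (baseTensor n e)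
        (Function.update (inc ht (Fin.cons a (e (b j β)))) j.succ
          (blockEquiv (ht j.succ) (Sum.inr k))) = A.mulVec F a := fun a => by
      rw [act_baseTensor_succ e ht, Matrix.mulVec, dotProduct]
      refine Finset.sum_congr rfl fun c _ => ?_
      congr 1
      · rw [Function.update_of_ne (Fin.succ_ne_zero j).symm]
        exact block_castLE_castLE ..
    simp only [h1]
    change A⁻¹.mulVec (A.mulVec F) (b j β) = _
    rw [Matrix.mulVec_mulVec, Matrix.nonsing_inv_mul _ ((Matrix.isUnit_iff_isUnit_det _).1 hw),
      Matrix.one_mulVec]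
    change ∏ j' : Fin m, _ = _
    rw [Finset.prod_eq_single j]
    · rw [Function.update_self, frame, block_inr_castLE, hb]
      rfl
    · intro j' _ hj
      have : j'.succ ≠ j.succ := fun h => hj (Fin.succ_injective _ h)
      rw [Function.update_of_ne this]
      exact (block_castLE_castLE (ht j'.succ) _ _ _ _ _ _).trans (Matrix.one_apply_eq _)
    · simp

end

/-! ### Smooth charts and local sections -/

section

section Smooth

variable {F : Type*} [NormedAddCommGroup F] [NormedSpace ℝ F] {x : F} {p : ℕ}

theorem contDiffAt_det {M : F → Matrix (Fin p) (Fin p) ℝ}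
    (hM : ∀ a b, ContDiffAt ℝ ∞ (fun y => M y a b) x) : ContDiffAt ℝ ∞ (fun y => (M y).det) x := by
  simp only [Matrix.det_apply]
  exact ContDiffAt.sum fun σ _ => (contDiffAt_prod fun i _ => hM _ _).const_smul _

/-- Cramer's rule: adjugate entries are determinants, divided by a determinant that is nonzero at
`x`. -/
theorem contDiffAt_inv_apply {M : F → Matrix (Fin p) (Fin p) ℝ}
    (hM : ∀ a b, ContDiffAt ℝ ∞ (fun y => M y a b) x) (hx : IsUnit (M x)) (a b : Fin p) :
    ContDiffAt ℝ ∞ (fun y => (M y)⁻¹ a b) x := by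
  simp only [Matrix.inv_def, Ring.inverse_eq_inv', Matrix.smul_apply, smul_eq_mul,
    Matrix.adjugate_apply]
  refine ((contDiffAt_det hM).inv ((Matrix.isUnit_iff_isUnit_det _).1 hx).ne_zero).mul
    (contDiffAt_det fun c d => ?_)
  by_cases hc : c = b
  · subst hc
    simpa only [Matrix.updateRow_self] using contDiffAt_const
  · simpa only [Matrix.updateRow_ne hc] using hM c d

end Smooth

variable {m : ℕ} {n t : Fin (m + 1) → ℕ}

section Smooth

variable {F : Type*} [NormedAddCommGroup F] [NormedSpace ℝ F] {x : F}

/-- The coordinates of a tuple of matrices. -/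
def MatProd.entries (n : Fin (m + 1) → ℕ) :
    MatProd n ≃L[ℝ] (∀ i, Fin (n i) → Fin (n i) → ℝ) :=
  LinearEquiv.toContinuousLinearEquiv
    { toFun := fun A => A
      invFun := fun A => A
      map_add' := fun _ _ => rfl
      map_smul' := fun _ _ => rfl
      left_inv := fun _ => rfl
      right_inv := fun _ => rfl }

theorem contDiffAt_matProd_iff {f : F → MatProd n} :
    ContDiffAt ℝ ∞ f x ↔ ∀ i k l, ContDiffAt ℝ ∞ (fun y => f y i k l) x := by
  rw [← (MatProd.entries n).comp_contDiffAt_iff]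
  simp only [contDiffAt_pi]
  rfl

theorem contDiffAt_act {A : F → MatProd n} {T : F → Tensor n} (hA : ContDiffAt ℝ ∞ A x)
    (hT : ContDiffAt ℝ ∞ T x) : ContDiffAt ℝ ∞ (fun y => act (A y) (T y)) x := by
  rw [contDiffAt_matProd_iff] at hA
  rw [contDiffAt_pi] at hT ⊢
  exact fun k => ContDiffAt.sum fun l _ => (contDiffAt_prod fun i _ => hA i _ _).mul (hT l)

theorem contDiff_smul_tensor (g : GLProd n) : ContDiff ℝ ∞ fun T : Tensor n => g • T :=
  contDiff_iff_contDiffAt.2 fun _ => contDiffAt_act contDiffAt_const contDiffAt_id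

end Smooth

variable (e : Fin (t 0) ≃ ∀ j : Fin m, Fin (t j.succ)) (ht : ∀ i, t i ≤ n i)

theorem isOpen_setOf_isUnit_core : IsOpen {T : Tensor n | IsUnit (core e ht T)} := by
  simp only [Matrix.isUnit_iff_isUnit_det, isUnit_iff_ne_zero]
  refine isOpen_ne.preimage (Continuous.matrix_det ?_)
  exact continuous_matrix fun a b => continuous_apply _

theorem isOpen_setOf_isUnit_fst : IsOpen {w : Param n t | IsUnit (Matrix.of w.1)} := by
  simp only [Matrix.isUnit_iff_isUnit_det, isUnit_iff_ne_zero]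
  refine isOpen_ne.preimage (Continuous.matrix_det ?_)
  exact continuous_matrix fun a b =>
    (continuous_apply b).comp ((continuous_apply a).comp continuous_fst)

theorem contDiffAt_frame (w : Param n t) : ContDiffAt ℝ ∞ (frame ht) w := by
  refine contDiffAt_matProd_iff.2 fun i k l => ?_
  obtain ⟨k, rfl⟩ := (blockEquiv (ht i)).surjective k
  obtain ⟨l, rfl⟩ := (blockEquiv (ht i)).surjective l
  have h2 : ∀ k l, ContDiffAt ℝ ∞ (fun w : Param n t => w.2 i k l) w := fun k l =>
    contDiffAt_pi.1 (contDiffAt_pi.1 (contDiffAt_pi.1 contDiffAt_snd i) k) l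
  have h1 : ∀ k l, ContDiffAt ℝ ∞ (fun w : Param n t => frameCorner w i k l) w := fun k l => by
    induction i using Fin.cases with
    | zero =>
      change ContDiffAt ℝ ∞ (fun w : Param n t => w.1 k l) w
      fun_prop
    | succ j => exact contDiffAt_const
  rcases k with k | k <;> rcases l with l | l <;>
    simp [frame, block, h1, h2, contDiffAt_const]

/-- The parameters of a tensor. -/
def coord (b : ∀ j : Fin m, Fin (t j.succ) → Fin (t 0)) (T : Tensor n) : Param n t :=
  (core e ht T, lowerBlock e ht b T)

theorem contDiffAt_coord (b : ∀ j : Fin m, Fin (t j.succ) → Fin (t 0)) {T : Tensor n}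
    (hT : IsUnit (core e ht T)) : ContDiffAt ℝ ∞ (coord e ht b) T := by
  have h : ∀ k, ContDiffAt ℝ ∞ (fun T : Tensor n => T k) T := fun k => by fun_prop
  refine ContDiffAt.prodMk ?_ ?_
  · exact contDiffAt_pi.2 fun a => contDiffAt_pi.2 fun b => h _
  · refine contDiffAt_pi.2 fun i => contDiffAt_pi.2 fun k => contDiffAt_pi.2 fun β => ?_
    induction i using Fin.cases with
    | zero => exact h _
    | succ j =>
      change ContDiffAt ℝ ∞ (fun T : Tensor n => ∑ a, (core e ht T)⁻¹ (b j β) a *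
        T (Function.update (inc ht (Fin.cons a (e (b j β)))) j.succ
          (blockEquiv (ht j.succ) (Sum.inr k)))) T
      refine ContDiffAt.sum fun a _ => ContDiffAt.mul ?_ (h _)
      exact contDiffAt_inv_apply (fun a b => h _) hT _ _

/-- The base tensor as an element of the set of tensors of multilinear rank `t`. -/
def basePoint (ht₀ : (∀ i, 1 ≤ t i) ∨ ∀ i, t i = 0) : mrankSet n t :=
  ⟨baseTensor n e, baseTensor_mem e ht ht₀⟩

/-- The frame as a group element, where it is invertible. -/
def frameUnit (w : Param n t) : GLProd n :=
  open scoped Classical in if h : IsUnit (Matrix.of w.1) then (isUnit_frame ht h).unit else 1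

theorem coe_frameUnit {w : Param n t} (hw : IsUnit (Matrix.of w.1)) :
    (frameUnit ht w : MatProd n) = frame ht w := by
  rw [frameUnit, dif_pos hw, IsUnit.unit_spec]

variable (ht₀ : (∀ i, 1 ≤ t i) ∨ ∀ i, t i = 0)

theorem coe_frameUnit_smul {w : Param n t} (hw : IsUnit (Matrix.of w.1)) :
    ((frameUnit ht w • basePoint e ht ht₀ : mrankSet n t) : Tensor n) =
      act (frame ht w) (baseTensor n e) := by
  rw [← coe_frameUnit ht hw]; rfl

theorem coord_frame {b : ∀ j : Fin m, Fin (t j.succ) → Fin (t 0)} (hb : ∀ j β, e (b j β) j = β)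
    {w : Param n t} (hw : IsUnit (Matrix.of w.1)) :
    coord e ht b (act (frame ht w) (baseTensor n e)) = w :=
  Prod.ext (core_frame e ht w) (lowerBlock_frame e ht hb hw)

theorem frameUnit_coord_smul {b : ∀ j : Fin m, Fin (t j.succ) → Fin (t 0)}
    (hb : ∀ j β, e (b j β) j = β) (T : mrankSet n t) (hT : IsUnit (core e ht T.1)) :
    frameUnit ht (coord e ht b T.1) • basePoint e ht ht₀ = T := by
  obtain ⟨w, hw⟩ := exists_frame e ht ht₀ T.2 hT
  rw [← hw, core_frame] at hT
  refine Subtype.ext ?_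
  rw [← hw, coord_frame e ht hb hT, coe_frameUnit_smul e ht ht₀ hT]

/-- The parametrization near the base tensor. -/
def baseParam {b : ∀ j : Fin m, Fin (t j.succ) → Fin (t 0)} (hb : ∀ j β, e (b j β) j = β) :
    SmoothParam (Subtype.val : mrankSet n t → Tensor n) (Param n t) where
  source := {T | IsUnit (core e ht T)}
  target := {w | IsUnit (Matrix.of w.1)}
  coord := coord e ht b
  param w := frameUnit ht w • basePoint e ht ht₀
  isOpen_source := isOpen_setOf_isUnit_core e ht
  isOpen_target := isOpen_setOf_isUnit_fst
  contDiffOn_coord T hT := (contDiffAt_coord e ht b hT).contDiffWithinAt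
  contDiffOn_param := by
    have : ContDiff ℝ ∞ fun w : Param n t => act (frame ht w) (baseTensor n e) :=
      contDiff_iff_contDiffAt.2 fun w => contDiffAt_act (contDiffAt_frame ht w) contDiffAt_const
    exact this.contDiffOn.congr fun w hw => coe_frameUnit_smul e ht ht₀ hw
  coord_mem _ hT := hT
  param_mem w hw := by
    change IsUnit (core e ht _)
    rw [coe_frameUnit_smul e ht ht₀ hw, core_frame]
    exact hw
  param_coord T hT := frameUnit_coord_smul e ht ht₀ hb T hT
  coord_param w hw := by rw [coe_frameUnit_smul e ht ht₀ hw, coord_frame e ht hb hw]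

theorem isUnit_core_baseTensor : IsUnit (core e ht (baseTensor n e)) := by
  have : core e ht (baseTensor n e) = 1 := by
    ext a b
    exact baseTensor_inc e ht a b
  rw [this]
  exact isUnit_one

include e ht ht₀ in
/-- Smooth local sections of the orbit maps. -/
theorem exists_contMDiffAt_section {D : ℕ}
    [ChartedSpace (EuclideanSpace ℝ (Fin D)) (mrankSet n t)]
    (hcoe : ContMDiff (𝓡 D) 𝓘(ℝ, Tensor n) ∞ (Subtype.val : mrankSet n t → Tensor n))
    (T : mrankSet n t) (g : GLProd n) :
    ∃ s : mrankSet n t → GLProd n, ContMDiffAt (𝓡 D) 𝓘(ℝ, MatProd n) ∞ s (g • T) ∧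
      s (g • T) = g ∧ ∀ᶠ x in nhds (g • T), s x • T = x := by
  choose b hb using fun j : Fin m => exists_idx_eq e ht₀ j.succ
  simp only [idx_succ] at hb
  have := isPretransitive e ht ht₀
  obtain ⟨k, hk⟩ := MulAction.exists_smul_eq (GLProd n) (basePoint e ht ht₀) (g • T)
  let s₀ : Tensor n → GLProd n := fun x => frameUnit ht (coord e ht b x)
  have hs₀ : s₀ (baseTensor n e) • basePoint e ht ht₀ = basePoint e ht ht₀ :=
    frameUnit_coord_smul e ht ht₀ hb (basePoint e ht ht₀) (isUnit_core_baseTensor e ht)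
  have hkx : k⁻¹ • (g • T).1 = baseTensor n e := by rw [← hk]; exact inv_smul_smul k _
  -- The section is `x ↦ k * s₀ (k⁻¹ • x) * c`: `k` moves the frame section from the base tensor to
  -- `g • T`, and the constant `c` sends `T` to the base point and makes the value at `g • T`
  -- exactly `g`.
  let c : GLProd n := (s₀ (baseTensor n e))⁻¹ * k⁻¹ * g
  have hc : c • T = basePoint e ht ht₀ := by
    rw [mul_smul, mul_smul, ← hk, inv_smul_smul, inv_smul_eq_iff, hs₀]
  have hopen : IsOpen {x : mrankSet n t | IsUnit (core e ht (k⁻¹ • x.1))} :=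
    (isOpen_setOf_isUnit_core e ht).preimage
      ((contDiff_smul_tensor k⁻¹).continuous.comp continuous_subtype_val)
  have hnhds : ∀ᶠ x in nhds (g • T), IsUnit (core e ht (k⁻¹ • x.1)) := by
    refine hopen.mem_nhds ?_
    change IsUnit (core e ht (k⁻¹ • (g • T).1))
    rw [hkx]
    exact isUnit_core_baseTensor e ht
  refine ⟨fun x => k * s₀ (k⁻¹ • x.1) * c, ?_, ?_, ?_⟩
  · refine contMDiffAt_units ?_
    have h1 : ContDiffAt ℝ ∞ (fun x : Tensor n => (k : MatProd n) *
        frame ht (coord e ht b (k⁻¹ • x)) * (c : MatProd n)) (g • T).1 := by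
      refine ContDiffAt.mul (contDiffAt_const.mul ?_) contDiffAt_const
      refine (contDiffAt_frame ht _).comp (g • T).1 (ContDiffAt.comp
        (g := coord e ht b) (f := fun x => k⁻¹ • x) (g • T).1 ?_
        (contDiff_smul_tensor k⁻¹).contDiffAt)
      rw [hkx]
      exact contDiffAt_coord e ht b (isUnit_core_baseTensor e ht)
    refine (h1.contMDiffAt.comp (g • T) (hcoe (g • T))).congr_of_eventuallyEq ?_
    filter_upwards [hnhds] with x hx
    change (k : MatProd n) * (frameUnit ht _ : MatProd n) * (c : MatProd n) = _
    rw [coe_frameUnit ht (w := coord e ht b (k⁻¹ • x.1)) hx]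
    rfl
  · change k * s₀ (k⁻¹ • (g • T).1) * c = g
    rw [hkx]
    simp [c, mul_assoc]
  · filter_upwards [hnhds] with x hx
    rw [mul_smul, hc, mul_smul, ← eq_inv_smul_iff]
    exact frameUnit_coord_smul e ht ht₀ hb (k⁻¹ • x) hx

/-- If `U` is a neighbourhood of `g`, points `x` near `π g` have `s x` in `U`, and `x = π (s x)`
lies in the image of `U`. -/
theorem isOpenMap_of_sections {X Y : Type*} [TopologicalSpace X] [TopologicalSpace Y] {π : X → Y}
    (h : ∀ g, ∃ s : Y → X, ContinuousAt s (π g) ∧ s (π g) = g ∧ ∀ᶠ x in nhds (π g), π (s x) = x) :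
    IsOpenMap π := by
  refine isOpenMap_iff_nhds_le.2 fun g U hU => ?_
  obtain ⟨s, hs, hsg, hsec⟩ := h g
  have := hs (hsg.symm ▸ Filter.mem_map.1 hU)
  filter_upwards [this, hsec] with x hx hx'
  rw [← hx']
  exact hx

theorem isHomeomorph_ofQuotientStabilizer {G X : Type*} [Group G] [TopologicalSpace G]
    [TopologicalSpace X] [MulAction G X] [MulAction.IsPretransitive G X] (x : X)
    (hc : Continuous fun g : G => g • x) (ho : IsOpenMap fun g : G => g • x) :
    IsHomeomorph (MulAction.ofQuotientStabilizer G x) := by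
  refine ⟨hc.quotient_lift _, fun U hU => ?_, MulAction.injective_ofQuotientStabilizer G x,
    fun y => ?_⟩
  · have h1 : MulAction.ofQuotientStabilizer G x '' U =
        (fun g : G => g • x) '' (QuotientGroup.mk ⁻¹' U) := by
      ext y
      constructor
      · rintro ⟨⟨g⟩, hg, rfl⟩
        exact ⟨g, hg, rfl⟩
      · rintro ⟨g, hg, rfl⟩
        exact ⟨_, hg, rfl⟩
    rw [h1]
    exact ho _ (hU.preimage continuous_quot_mk)
  · obtain ⟨g, hg⟩ := MulAction.exists_smul_eq G x y
    exact ⟨g, hg⟩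

end

/-! ### The homogeneous manifold -/

section

variable {m : ℕ} {n t : Fin (m + 1) → ℕ} (e : Fin (t 0) ≃ ∀ j : Fin m, Fin (t j.succ))
  (ht : ∀ i, t i ≤ n i) (ht₀ : (∀ i, 1 ≤ t i) ∨ ∀ i, t i = 0)

include e ht ht₀ in
/-- The manifold structure that makes the set of tensors of multilinear rank `t` a submanifold of
the space of tensors. -/
theorem exists_submanifold :
    ∃ (D : ℕ) (_ : ChartedSpace (EuclideanSpace ℝ (Fin D)) (mrankSet n t)),
      IsManifold (𝓡 D) ∞ (mrankSet n t) ∧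
      ContMDiff (𝓡 D) 𝓘(ℝ, Tensor n) ∞ (Subtype.val : mrankSet n t → Tensor n) ∧
      ContMDiffSMul 𝓘(ℝ, MatProd n) (𝓡 D) ∞ (GLProd n) (mrankSet n t) := by
  choose b hb using fun j : Fin m => exists_idx_eq e ht₀ j.succ
  simp only [idx_succ] at hb
  have := isPretransitive e ht ht₀
  choose k hk using MulAction.exists_smul_eq (GLProd n) (basePoint e ht ht₀)
  let c : mrankSet n t → SmoothParam (Subtype.val : mrankSet n t → Tensor n)
      (EuclideanSpace ℝ (Fin (Module.finrank ℝ (Param n t)))) := fun x =>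
    ((baseParam e ht ht₀ hb).translate (fun _ _ => rfl) contDiff_smul_tensor (k x)).mapEquiv
      toEuclidean
  have hc : ∀ x, x.1 ∈ (c x).source := fun x => by
    change IsUnit (core e ht ((k x)⁻¹ • x.1))
    have : (k x)⁻¹ • x.1 = baseTensor n e :=
      inv_smul_eq_iff.2 (congrArg Subtype.val (hk x)).symm
    rw [this]
    exact isUnit_core_baseTensor e ht
  have hi : Topology.IsEmbedding (Subtype.val : mrankSet n t → Tensor n) := .subtypeVal
  let := SmoothParam.chartedSpace hi c hc
  have hcoe := SmoothParam.contMDiff_coe hi c hc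
  refine ⟨_, SmoothParam.chartedSpace hi c hc, SmoothParam.isManifold hi c hc, hcoe, ⟨?_⟩⟩
  intro p
  -- In the ambient space the action is polynomial in the entries of the matrices and of the tensor.
  refine SmoothParam.contMDiffAt_of_coe hi c hc ?_
  have h1 : ContDiff ℝ ∞ fun q : MatProd n × Tensor n => act q.1 q.2 :=
    contDiff_iff_contDiffAt.2 fun q => contDiffAt_act contDiffAt_fst contDiffAt_snd
  have h2 : ContMDiff (𝓘(ℝ, MatProd n).prod
      (𝓡 (Module.finrank ℝ (Param n t)))) 𝓘(ℝ, MatProd n × Tensor n) ∞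
      fun q : GLProd n × mrankSet n t => ((q.1 : MatProd n), q.2.1) :=
    (Units.contMDiff_val.comp contMDiff_fst).prodMk_space (hcoe.comp contMDiff_snd)
  exact (h1.contMDiff.comp h2) p

end

end Tucker

end

theorem mainTheorem3 {m : ℕ} (hm : 2 ≤ m) (n t : Fin (m + 1) → ℕ) (hn : ∀ i, 2 ≤ n i)
    (ht : ∀ i, t i ≤ n i) (ht₀ : (∀ i, 1 ≤ t i) ∨ ∀ i, t i = 0)
    (h : t 0 = ∏ j : Fin m, t j.succ) :
    -- `G` acts transitively on the (nonempty) set of tensors of multilinear rank `t`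
    Nonempty (Tucker.mrankSet n t) ∧
    MulAction.IsPretransitive (Tucker.GLProd n) (Tucker.mrankSet n t) ∧
    -- this set is a smooth manifold on which `G` acts smoothly
    ∃ (D : ℕ) (_ : ChartedSpace (EuclideanSpace ℝ (Fin D)) (Tucker.mrankSet n t)),
      IsManifold (𝓡 D) ∞ (Tucker.mrankSet n t) ∧
      ContMDiffSMul 𝓘(ℝ, Tucker.MatProd n) (𝓡 D) ∞ (Tucker.GLProd n) (Tucker.mrankSet n t) ∧
      -- for the base tensor `T` (and every identification `e` used to write it down):
      ∀ e : Fin (t 0) ≃ ∀ j : Fin m, Fin (t j.succ),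
        ∃ hT : Tucker.baseTensor n e ∈ Tucker.mrankSet n t,
          let T : Tucker.mrankSet n t := ⟨Tucker.baseTensor n e, hT⟩
          let π : Tucker.GLProd n → Tucker.mrankSet n t := fun g => g • T
          -- the stabilizer `H` of `T` is the explicit one
          (MulAction.stabilizer (Tucker.GLProd n) T : Set (Tucker.GLProd n)) =
            Tucker.stabilizerForm ht e ∧
          -- `g H ↦ g • T` is a homeomorphism from `G / H` onto the set
          IsHomeomorph (MulAction.ofQuotientStabilizer (Tucker.GLProd n) T) ∧
          -- the manifold structure is that of `G / H`: `π` is a smooth submersion, and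
          -- smoothness of functions on the quotient is detected by `π`
          ContMDiff 𝓘(ℝ, Tucker.MatProd n) (𝓡 D) ∞ π ∧
          (∀ g, Function.Surjective (mfderiv 𝓘(ℝ, Tucker.MatProd n) (𝓡 D) π g)) ∧
          ∀ f : Tucker.mrankSet n t → ℝ,
            ContMDiff (𝓡 D) 𝓘(ℝ, ℝ) ∞ f ↔
              ContMDiff 𝓘(ℝ, Tucker.MatProd n) 𝓘(ℝ, ℝ) ∞ (f ∘ π) := by
  -- One identification fixes the manifold structure. Its local sections exist for the orbit map of
  -- any point, so they serve the base tensor of every other `e`.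
  have e₀ : Fin (t 0) ≃ ∀ j : Fin m, Fin (t j.succ) := Fintype.equivOfCardEq (by simp [h])
  have htr := Tucker.isPretransitive e₀ ht ht₀
  obtain ⟨D, inst, hM, hcoe, hsmul⟩ := Tucker.exists_submanifold e₀ ht ht₀
  refine ⟨⟨Tucker.basePoint e₀ ht ht₀⟩, htr, D, inst, hM, hsmul, fun e =>
    ⟨Tucker.baseTensor_mem e ht ht₀, ?_⟩⟩
  intro T π
  have hπ : ContMDiff 𝓘(ℝ, Tucker.MatProd n) (𝓡 D) ∞ π :=
    hsmul.contMDiff_smul.comp (contMDiff_id.prodMk contMDiff_const)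
  have hsec := Tucker.exists_contMDiffAt_section e₀ ht ht₀ hcoe T
  refine ⟨?_, ?_, hπ, fun g => ?_, fun f => ⟨fun hf => hf.comp hπ, fun hf p => ?_⟩⟩
  · rw [← Tucker.stabilizer_eq e ht ht₀]
    ext g
    exact Subtype.ext_iff
  · refine Tucker.isHomeomorph_ofQuotientStabilizer T hπ.continuous
      (Tucker.isOpenMap_of_sections fun g => ?_)
    obtain ⟨s, hs, hsg, hsT⟩ := hsec g
    exact ⟨s, hs.continuousAt, hsg, hsT⟩
  · obtain ⟨s, hs, hsg, hsT⟩ := hsec g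
    have h1 := (hs.mdifferentiableAt (by simp)).hasMFDerivAt
    have h2 : HasMFDerivAt 𝓘(ℝ, Tucker.MatProd n) (𝓡 D) π (s (g • T))
        (mfderiv 𝓘(ℝ, Tucker.MatProd n) (𝓡 D) π (s (g • T))) :=
      ((hπ _).mdifferentiableAt (by simp)).hasMFDerivAt
    -- Differentiating `π ∘ s = id` gives a right inverse of the derivative of `π` at `s (g • T) =
    -- g`.
    have h3 := (h2.comp (g • T) h1).congr_of_eventuallyEq
      (f₁ := id) (by filter_upwards [hsT] with x hx using hx.symm)
    have h4 := hasMFDerivAt_unique h3 (hasMFDerivAt_id (g • T))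
    rw [hsg] at h4
    intro v
    exact ⟨_, DFunLike.congr_fun h4 v⟩
  · obtain ⟨g, rfl⟩ := MulAction.exists_smul_eq (Tucker.GLProd n) T p
    obtain ⟨s, hs, hsg, hsT⟩ := hsec g
    -- Near `g • T`, `f` agrees with `(f ∘ π) ∘ s`.
    refine ((hf (s (g • T))).comp (g • T) hs).congr_of_eventuallyEq ?_
    filter_upwards [hsT] with x hx
    exact congrArg f hx.symm
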